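/- Let $\mathcal{T}$ be a triangulated category with shift $[1]$. Let $\mathcal{A}\subset\mathcal{T}$ be a full additive subcategory, closed under extensions, such that $\operatorname{Hom}_{\mathcal{T}}(A,B[-1])=0$ for all $A,B\in\mathcal{A}$. Call $B\to X\to A$ in $\mathcal{A}$ a conflation if it can be completed to a distinguished triangle $B\to X\to A\to B[1]$ of $\mathcal{T}$ (the morphism $A\to B[1]$ is then unique). For $n\ge 1$, an $n$-extension of $A$ by $B$ is a sequence $0\to B\to X_1\to\dots\to X_n\to A\to 0$ in $\mathcal{A}$ obtained by splicing conflations $B\to X_1\to C_1$, $C_1\to X_2\to C_2$, …, $C_{n-1}\to X_n\to A$. Let $\operatorname{Ext}^n_{\mathcal{A}}(A,B)$ be the set of $n$-extensions modulo the equivalence relation generated by the existence of a commutative ladder that is the identity on $A$ and $B$, with addition given by the Baer sum $\mathbf{X}+\mathbf{Y}=\nabla_B\cdot(\mathbf{X}\oplus\mathbf{Y})\cdot\Delta_A$, and let $\operatorname{Ext}^0_{\mathcal{A}}(A,B)=\operatorname{Hom}_{\mathcal{A}}(A,B)$. Sending an $n$-extension to the composition of the shifted connecting morphisms $A\to C_{n-1}[1]\to\dots\to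 C_1[n-1]\to B[n]$ (and a morphism to itself if $n=0$) gives a well-defined map $f_{n,A,B}:\operatorname{Ext}^n_{\mathcal{A}}(A,B)\to\operatorname{Hom}_{\mathcal{T}}(A,B[n])$. One says that $\mathcal{T}$ has all the Ext groups of $\mathcal{A}$ if $f_{n,A,B}$ is an isomorphism of groups for all $n\ge 0$ and all $A,B\in\mathcal{A}$. 1. $\mathcal{T}$ has all the Ext groups of $\mathcal{A}$ if and only if, for all $n\ge 1$ and all $A,B\in\mathcal{A}$, every morphism $A\to B[n]$ in $\mathcal{T}$ factors as $$A\to C_{n-1}[1]\to C_{n-2}[2]\to\dots\to C_1[n-1]\to B[n]$$ with $C_1,\dots,C_{n-1}\in\mathcal{A}$. 2. Let $\mathcal{A}$ be the heart of a t-structure on $\mathcal{T}$ (such a heart satisfies the above conditions). Let $\dim_{\mathcal{T}}\mathcal{A}$ be the supremum of the integers $n$ such that $\operatorname{Hom}_{\mathcal{T}}(A,B[n])\ne 0$ for some $A,B\in\mathcal{A}$, and let $\dim\mathcal{A}$ be the supremum of the integers $n\ge 0$ such that $\operatorname{Ext}^n(A,B)\neq 0$ for some $A,B\in\mathcal{A}$,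 where $\operatorname{Ext}^n$ denotes the Yoneda extensions of the abelian category $\mathcal{A}$, defined as above with the short exact sequences of $\mathcal{A}$ as conflations (both suprema are $-\infty$ if $\mathcal{A}=0$). If $\dim_{\mathcal{T}}\mathcal{A}\le 1$, then $\mathcal{T}$ has all the Ext groups of $\mathcal{A}$ and $\dim\mathcal{A}=\dim_{\mathcal{T}}\mathcal{A}$. -/

import Mathlib

open CategoryTheory Category Limits Pretriangulated Triangulated

universe v u

-- The quiver of a category is taken directly from its category structure.
attribute [-instance] CategoryTheory.catToReflQuiver

namespace ExtGroups

/-! ### Yoneda extensions with respect to a class of conflations -/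

section Yoneda

variable {D : Type u} [Category.{v} D]

/-- A class of conflations: a predicate on composable pairs `X ⟶ Y ⟶ Z`. -/
abbrev ConflationClass (D : Type u) [Category.{v} D] : Type (max u v) :=
  ∀ ⦃X Y Z : D⦄, (X ⟶ Y) → (Y ⟶ Z) → Prop

/-- `NExtension conf A k B` is the type of `(k + 1)`-extensions
`0 ⟶ B ⟶ X₁ ⟶ ⋯ ⟶ X_{k+1} ⟶ A ⟶ 0` of `A` by `B`, i.e. of sequences obtained by splicing
conflations `B ⟶ X₁ ⟶ C₁`, `C₁ ⟶ X₂ ⟶ C₂`, …, `C_k ⟶ X_{k+1} ⟶ A`. -/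
inductive NExtension (conf : ConflationClass D) (A : D) : ℕ → D → Type (max u v)
  | single {B X : D} (i : B ⟶ X) (p : X ⟶ A) (h : conf i p) : NExtension conf A 0 B
  | splice {k : ℕ} {B X K : D} (i : B ⟶ X) (p : X ⟶ K) (h : conf i p)
      (E : NExtension conf A k K) : NExtension conf A (k + 1) B

namespace NExtension

variable {conf : ConflationClass D} {A : D}

/-- The first middle term `X₁` of an extension. -/
def firstObj : ∀ {k : ℕ} {B : D}, NExtension conf A k B → D
  | _, _, single (X := X) _ _ _ => X
  | _, _, splice (X := X) _ _ _ _ => X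

/-- The first map `ξ₀ : B ⟶ X₁` of an extension. -/
def firstMap : ∀ {k : ℕ} {B : D} (E : NExtension conf A k B), B ⟶ E.firstObj
  | _, _, single i _ _ => i
  | _, _, splice i _ _ _ => i

/-- Given `ψ₁ : X₁ ⟶ Y₁`, there are maps `ψ₂ : X₂ ⟶ Y₂`, … such that all the squares
to the right of `ψ₁` commute, the last one being over the identity of `A`.
The map `X₁ ⟶ X₂` is the composition `X₁ ⟶ C₁ ⟶ X₂`. -/
def LadderFrom : ∀ {k : ℕ} {B B' : D} (E : NExtension conf A k B) (E' : NExtension conf A k B'),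
    (E.firstObj ⟶ E'.firstObj) → Prop
  | _, _, _, single _ p _, single _ p' _, ψ => ψ ≫ p' = p
  | _, _, _, splice _ p _ E, splice _ p' _ E', ψ =>
      ∃ ψ' : E.firstObj ⟶ E'.firstObj,
        (p ≫ E.firstMap) ≫ ψ' = ψ ≫ (p' ≫ E'.firstMap) ∧ LadderFrom E E' ψ'

/-- There is a family `ψ₁, …, ψ_{k+1}` of morphisms between the middle terms of two extensions
of `A` by `B` which, together with the identities of `A` and `B`, form a commutative diagram. -/
def Rel {k : ℕ} {B : D} (E E' : NExtension conf A k B) : Prop :=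
  ∃ ψ : E.firstObj ⟶ E'.firstObj, E.firstMap ≫ ψ = E'.firstMap ∧ LadderFrom E E' ψ

/-- Existence of a morphism of extensions over `α : A ⟶ A'` and `β : B ⟶ B'`,
given by maps between the middle terms `X_i` and between the `C_i`. -/
def IsOver {A A' : D} (α : A ⟶ A') : ∀ {k : ℕ} {B B' : D} (_ : B ⟶ B')
    (_ : NExtension conf A k B) (_ : NExtension conf A' k B'), Prop
  | _, _, _, β, single (X := X) i p _, single (X := X') i' p' _ =>
      ∃ ψ : X ⟶ X', i ≫ ψ = β ≫ i' ∧ ψ ≫ p' = p ≫ α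
  | _, _, _, β, splice (X := X) (K := K) i p _ E, splice (X := X') (K := K') i' p' _ E' =>
      ∃ (ψ : X ⟶ X') (φ : K ⟶ K'), i ≫ ψ = β ≫ i' ∧ ψ ≫ p' = p ≫ φ ∧ IsOver α φ E E'

lemma IsOver.comp {A A' A'' : D} {α : A ⟶ A'} {α' : A' ⟶ A''} {k : ℕ} {B B' B'' : D} {β : B ⟶ B'}
    {β' : B' ⟶ B''} {E : NExtension conf A k B} {E' : NExtension conf A' k B'}
    {E'' : NExtension conf A'' k B''} (h : IsOver α β E E') (h' : IsOver α' β' E' E'') :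
    IsOver (α ≫ α') (β ≫ β') E E'' := by
  induction E generalizing B' B'' with
  | single i p hc =>
    cases E' with
    | single i' p' hc' =>
    cases E'' with
    | single i'' p'' hc'' =>
    obtain ⟨ψ, h₁, h₂⟩ := h
    obtain ⟨ψ', h₁', h₂'⟩ := h'
    exact ⟨ψ ≫ ψ', by rw [reassoc_of% h₁, h₁', assoc], by rw [assoc, h₂', reassoc_of% h₂]⟩
  | splice i p hc E ih =>
    cases E' with
    | splice i' p' hc' E' =>
    cases E'' with
    | splice i'' p'' hc'' E'' =>
    obtain ⟨ψ, φ, h₁, h₂, h₃⟩ := h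
    obtain ⟨ψ', φ', h₁', h₂', h₃'⟩ := h'
    exact ⟨ψ ≫ ψ', φ ≫ φ', by rw [reassoc_of% h₁, h₁', assoc],
      by rw [assoc, h₂', reassoc_of% h₂], ih h₃ h₃'⟩

lemma IsOver.refl {A : D} {k : ℕ} {B : D} (E : NExtension conf A k B) : IsOver (𝟙 A) (𝟙 B) E E := by
  induction E with
  | single i p hc => exact ⟨𝟙 _, by simp, by simp⟩
  | splice i p hc E ih => exact ⟨𝟙 _, 𝟙 _, by simp, by simp, ih⟩

end NExtension

/-- The Yoneda extensions `Extⁿ(A, B)` with respect to a class of conflations: morphisms `A ⟶ B`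
for `n = 0`, and the quotient of the `n`-extensions by the equivalence relation generated by
`NExtension.Rel` for `n > 0`. -/
def YExt (conf : ConflationClass D) : ℕ → D → D → Type (max u v)
  | 0, A, B => ULift.{u} (A ⟶ B)
  | k + 1, A, B => Quot (NExtension.Rel : NExtension conf A k B → NExtension conf A k B → Prop)

/-- The greatest `n` such that `Extⁿ(A, B) ≠ 0` for some `A` and `B` (the supremum is
`⊥` if there is no such `n`, and `⊤` if these `n` are not bounded). -/
noncomputable def extDim (conf : ConflationClass D) : WithBot (WithTop ℤ) :=
  ⨆ (n : ℕ) (_ : ∃ A B : D, Nontrivial (YExt conf n A B)), (((n : ℤ) : WithTop ℤ) : WithBot (WithTop ℤ))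

end Yoneda

/-- The short exact sequences of an abelian category. -/
def shortExactSequences (D : Type u) [Category.{v} D] [Preadditive D] : ConflationClass D :=
  fun _ _ _ i p => ∃ w : i ≫ p = 0, (ShortComplex.mk i p w).ShortExact

/-- The (absolute) homological dimension `dim D` of an abelian category. -/
noncomputable def absDim (D : Type u) [Category.{v} D] [Preadditive D] : WithBot (WithTop ℤ) :=
  extDim (shortExactSequences D)

/-! ### Exact subcategories of triangulated categories -/

lemma comp_shift_inv_hom {C : Type u} [Category.{v} C] [HasShift C ℤ] {X Y Z W : C} (a : X ⟶ Y) (m : Y ⟶ Z⟦(1 : ℤ)⟧) (e : W ≅ Z) :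
    (a ≫ m ≫ e.inv⟦(1 : ℤ)⟧') ≫ e.hom⟦(1 : ℤ)⟧' = a ≫ m := by
  rw [assoc, assoc, ← Functor.map_comp, Iso.inv_hom_id, CategoryTheory.Functor.map_id, comp_id]

section Triangulated

variable {C : Type u} [Category.{v} C] [Preadditive C] [HasZeroObject C] [HasShift C ℤ]
  [∀ n : ℤ, (shiftFunctor C n).Additive] [Pretriangulated C]

/-- A full additive subcategory, closed under extensions, such that `Hom(A, B[-1]) = 0` for all
its objects `A` and `B`. (Closure under finite direct sums and isomorphisms follows from
closure under extensions.) -/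
class IsDyerSubcategory (P : ObjectProperty C) : Prop where
  exists_zero : ∃ Z : C, IsZero Z ∧ P Z
  ext_closed : ∀ T ∈ distTriang C, P T.obj₁ → P T.obj₃ → P T.obj₂
  hom_zero : ∀ {A B : C}, P A → P B → ∀ f : A ⟶ B⟦(-1 : ℤ)⟧, f = 0

/-- The exact structure on a full subcategory of a triangulated category:
`A ⟶ B ⟶ C` is a conflation if it can be completed to a distinguished triangle. -/
def triangleConflations (P : ObjectProperty C) : ConflationClass P.FullSubcategory :=
  fun X _ Z i p => ∃ γ : Z.obj ⟶ X.obj⟦(1 : ℤ)⟧, Triangle.mk i.hom p.hom γ ∈ distTriang C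

/-- The homological dimension `dim_T P` of a full subcategory: the greatest integer `n` such that
`Hom(A, B[n]) ≠ 0` for some `A` and `B` in `P` (the supremum is `⊥` if there is no such `n`,
and `⊤` if these `n` are not bounded above). -/
noncomputable def dimIn (P : ObjectProperty C) : WithBot (WithTop ℤ) :=
  ⨆ (n : ℤ) (_ : ∃ A B : C, P A ∧ P B ∧ ∃ f : A ⟶ B⟦n⟧, f ≠ 0), ((n : WithTop ℤ) : WithBot (WithTop ℤ))

/-- `FactorsThrough P A n B g` says that `g : A ⟶ B[n]` (with `n ≥ 1`) is a composition
`A ⟶ C_{n-1}[1] ⟶ ⋯ ⟶ C₁[n-1] ⟶ B[n]` with all `C_i` in `P`. -/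
inductive FactorsThrough (P : ObjectProperty C) (A : C) :
    ∀ (n : ℕ) (B : C), (A ⟶ B⟦(n : ℤ)⟧) → Prop
  | one {B : C} (g : A ⟶ B⟦((1 : ℕ) : ℤ)⟧) : FactorsThrough P A 1 B g
  | step {n : ℕ} {K B : C} (hK : P K) (g : A ⟶ K⟦(n : ℤ)⟧) (hg : FactorsThrough P A n K g)
      (h : K⟦(n : ℤ)⟧ ⟶ B⟦((n + 1 : ℕ) : ℤ)⟧) : FactorsThrough P A (n + 1) B (g ≫ h)

/-- A chosen comparison between the biproduct and the product of a pair of objects. -/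
noncomputable def biprodIsoPi (F : WalkingPair → C) : F .left ⊞ F .right ≅ ∏ᶜ F where
  hom := Pi.lift (fun j => match j with
    | .left => biprod.fst
    | .right => biprod.snd)
  inv := biprod.lift (Pi.π F .left) (Pi.π F .right)
  hom_inv_id := by ext <;> simp
  inv_hom_id := by
    apply Pi.hom_ext
    rintro (_ | _) <;> simp

lemma biprodIsoPi_left (F : WalkingPair → C) :
    (biprodIsoPi F).hom ≫ Pi.π F .left = biprod.fst := by simp [biprodIsoPi]

lemma biprodIsoPi_right (F : WalkingPair → C) :
    (biprodIsoPi F).hom ≫ Pi.π F .right = biprod.snd := by simp [biprodIsoPi]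

lemma biprodIsoPi_natural (F G : WalkingPair → C) (f : ∀ j, F j ⟶ G j) :
    biprod.map (f .left) (f .right) ≫ (biprodIsoPi G).hom =
      (biprodIsoPi F).hom ≫ Limits.Pi.map f := by
  apply Pi.hom_ext
  rintro (_ | _)
  · rw [assoc, assoc, biprodIsoPi_left, Limits.Pi.map_π, biprod.map_fst, ← assoc,
      biprodIsoPi_left]
  · rw [assoc, assoc, biprodIsoPi_right, Limits.Pi.map_π, biprod.map_snd, ← assoc,
      biprodIsoPi_right]

lemma biprod_distinguished' (T : WalkingPair → Triangle C) (hT : ∀ j, T j ∈ distTriang C) :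
    ∃ δ, Triangle.mk (biprod.map (T .left).mor₁ (T .right).mor₁)
      (biprod.map (T .left).mor₂ (T .right).mor₂) δ ∈ distTriang C := by
  refine ⟨(biprodIsoPi fun j => (T j).obj₃).hom ≫ (productTriangle T).mor₃ ≫
    (biprodIsoPi fun j => (T j).obj₁).inv⟦(1 : ℤ)⟧', ?_⟩
  refine isomorphic_distinguished _ (productTriangle_distinguished T hT) _ ?_
  refine Triangle.isoMk _ _ (biprodIsoPi fun j => (T j).obj₁) (biprodIsoPi fun j => (T j).obj₂)
    (biprodIsoPi fun j => (T j).obj₃) ?_ ?_ ?_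
  · exact biprodIsoPi_natural _ _ fun j => (T j).mor₁
  · exact biprodIsoPi_natural _ _ fun j => (T j).mor₂
  · exact comp_shift_inv_hom _ _ _

lemma biprod_distinguished {X Y Z X' Y' Z' : C} {i : X ⟶ Y} {p : Y ⟶ Z} {γ : Z ⟶ X⟦(1 : ℤ)⟧}
    {i' : X' ⟶ Y'} {p' : Y' ⟶ Z'} {γ' : Z' ⟶ X'⟦(1 : ℤ)⟧}
    (h : Triangle.mk i p γ ∈ distTriang C) (h' : Triangle.mk i' p' γ' ∈ distTriang C) :
    ∃ δ, Triangle.mk (biprod.map i i') (biprod.map p p') δ ∈ distTriang C :=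
  biprod_distinguished' (fun j => match j with
    | .left => Triangle.mk i p γ
    | .right => Triangle.mk i' p' γ') (by rintro (_ | _) <;> assumption)

section

variable {P : ObjectProperty C} {B X A B' X' A' : P.FullSubcategory}
  {i : B ⟶ X} {p : X ⟶ A} {i' : B' ⟶ X'} {p' : X' ⟶ A'}

lemma conf_zero (h : triangleConflations P i p) : i ≫ p = 0 := by
  obtain ⟨γ, hγ⟩ := h
  ext
  exact comp_distTriang_mor_zero₁₂ _ hγ

lemma conf_desc (h : triangleConflations P i p) {Z : P.FullSubcategory} (f : X ⟶ Z)
    (hf : i ≫ f = 0) : ∃ g : A ⟶ Z, f = p ≫ g := by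
  obtain ⟨γ, hγ⟩ := h
  obtain ⟨t, ht⟩ := Triangle.yoneda_exact₂ _ hγ f.hom (congrArg (·.hom) hf)
  exact ⟨P.homMk t, by ext; exact ht⟩

/-- The connecting morphism `A ⟶ B[1]` of a conflation `B ⟶ X ⟶ A`; it is unique,
see `conf_natural`. -/
noncomputable def conn (h : triangleConflations P i p) : A.obj ⟶ B.obj⟦(1 : ℤ)⟧ := h.choose

lemma conn_mem (h : triangleConflations P i p) :
    Triangle.mk i.hom p.hom (conn h) ∈ distTriang C := h.choose_spec

lemma exists_middle (h : triangleConflations P i p) (h' : triangleConflations P i' p')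
    (β : B ⟶ B') (φ : A ⟶ A') (hφ : φ.hom ≫ conn h' = conn h ≫ β.hom⟦(1 : ℤ)⟧') :
    ∃ ψ : X ⟶ X', i ≫ ψ = β ≫ i' ∧ ψ ≫ p' = p ≫ φ := by
  obtain ⟨c, hc₁, hc₂⟩ := complete_distinguished_triangle_morphism₂ _ _ (conn_mem h) (conn_mem h')
    β.hom φ.hom hφ.symm
  exact ⟨P.homMk c, by ext; exact hc₁, by ext; exact hc₂.symm⟩

end

section Dyer

variable {P : ObjectProperty C} [IsDyerSubcategory P]

lemma hom_shift_one_eq_zero {A B : C} (hA : P A) (hB : P B) (f : A⟦(1 : ℤ)⟧ ⟶ B) : f = 0 := by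
  apply (shiftFunctor C (-1 : ℤ)).map_injective
  rw [Functor.map_zero, ← cancel_epi ((shiftFunctorCompIsoId C (1 : ℤ) (-1) (by simp)).inv.app A),
    comp_zero]
  exact IsDyerSubcategory.hom_zero hA hB _

section

variable {B X A B' X' A' : P.FullSubcategory} {i : B ⟶ X} {p : X ⟶ A} {i' : B' ⟶ X'} {p' : X' ⟶ A'}

lemma conf_epi (h : triangleConflations P i p) {Z : P.FullSubcategory} {f g : A ⟶ Z}
    (hfg : p ≫ f = p ≫ g) : f = g := by
  obtain ⟨γ, hγ⟩ := h
  ext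
  rw [← sub_eq_zero]
  have h0 : p.hom ≫ (f.hom - g.hom) = 0 := by
    rw [Preadditive.comp_sub, sub_eq_zero]
    exact congrArg (·.hom) hfg
  obtain ⟨t, ht⟩ := Triangle.yoneda_exact₃ _ hγ (f.hom - g.hom) h0
  rw [ht, hom_shift_one_eq_zero B.property Z.property t]
  exact comp_zero

lemma conf_mono (h : triangleConflations P i p) {Z : P.FullSubcategory} {f g : Z ⟶ B}
    (hfg : f ≫ i = g ≫ i) : f = g := by
  obtain ⟨γ, hγ⟩ := h
  ext
  rw [← sub_eq_zero]
  have h0 : (f.hom - g.hom) ≫ i.hom = 0 := by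
    rw [Preadditive.sub_comp, sub_eq_zero]
    exact congrArg (·.hom) hfg
  obtain ⟨t, ht⟩ := Triangle.coyoneda_exact₂ _ (inv_rot_of_distTriang _ hγ) (f.hom - g.hom) h0
  have : t = 0 := IsDyerSubcategory.hom_zero Z.property A.property t
  rw [ht, this]
  exact zero_comp

lemma conf_natural {γ : A.obj ⟶ B.obj⟦(1 : ℤ)⟧} {γ' : A'.obj ⟶ B'.obj⟦(1 : ℤ)⟧}
    (hγ : Triangle.mk i.hom p.hom γ ∈ distTriang C)
    (hγ' : Triangle.mk i'.hom p'.hom γ' ∈ distTriang C)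
    (β : B ⟶ B') (ψ : X ⟶ X') (φ : A ⟶ A') (h₁ : i ≫ ψ = β ≫ i') (h₂ : ψ ≫ p' = p ≫ φ) :
    φ.hom ≫ γ' = γ ≫ β.hom⟦(1 : ℤ)⟧' := by
  obtain ⟨c, hc₁, hc₂⟩ := complete_distinguished_triangle_morphism _ _ hγ hγ' β.hom ψ.hom
    (congrArg (·.hom) h₁)
  have : φ = P.homMk c := by
    apply conf_epi ⟨γ, hγ⟩
    rw [← h₂]
    ext
    exact hc₁.symm
  subst this
  exact hc₂.symm

lemma conn_natural (h : triangleConflations P i p) (h' : triangleConflations P i' p')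
    (β : B ⟶ B') (ψ : X ⟶ X') (φ : A ⟶ A') (h₁ : i ≫ ψ = β ≫ i') (h₂ : ψ ≫ p' = p ≫ φ) :
    φ.hom ≫ conn h' = conn h ≫ β.hom⟦(1 : ℤ)⟧' :=
  conf_natural (conn_mem h) (conn_mem h') β ψ φ h₁ h₂

lemma exists_conf (γ : A.obj ⟶ B.obj⟦(1 : ℤ)⟧) :
    ∃ (Y : P.FullSubcategory) (j : B ⟶ Y) (q : Y ⟶ A) (h : triangleConflations P j q),
      conn h = γ := by
  obtain ⟨Y, j, q, hT⟩ := distinguished_cocone_triangle₂ γ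
  have hY : P Y := IsDyerSubcategory.ext_closed _ hT B.property A.property
  have h : triangleConflations P (P.homMk j : B ⟶ ⟨Y, hY⟩) (P.homMk q) := ⟨γ, hT⟩
  refine ⟨⟨Y, hY⟩, P.homMk j, P.homMk q, h, ?_⟩
  have := conf_natural (P := P) (i := P.homMk j) (p := P.homMk q) (i' := P.homMk j)
    (p' := P.homMk q) hT (conn_mem h) (𝟙 B) (𝟙 (⟨Y, hY⟩ : P.FullSubcategory)) (𝟙 A)
    (by simp) (by simp)
  simpa using this

/-- A pushout of the conflation `B ⟶ X ⟶ A` along `g : B ⟶ B'`: a conflation `B' ⟶ Y ⟶ A`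
with a morphism `X ⟶ Y` making the diagram commute. (The square `B, X, B', Y` is then a
pushout, and the conflation is unique up to isomorphism.) -/
structure PushData (_ : triangleConflations P i p) (g : B ⟶ B') where
  (Y : P.FullSubcategory) (j : B' ⟶ Y) (q : Y ⟶ A) (conf : triangleConflations P j q) (ψ : X ⟶ Y)
  w₁ : i ≫ ψ = g ≫ j
  w₂ : ψ ≫ q = p ≫ 𝟙 A

/-- A pullback of the conflation `B ⟶ X ⟶ A` along `a : A' ⟶ A`: a conflation `B ⟶ Y ⟶ A'`
with a morphism `Y ⟶ X` making the diagram commute. (The square `Y, X, A', A` is then a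
pullback, and the conflation is unique up to isomorphism.) -/
structure PullData (_ : triangleConflations P i p) (a : A' ⟶ A) where
  (Y : P.FullSubcategory) (j : B ⟶ Y) (q : Y ⟶ A') (conf : triangleConflations P j q) (ψ : Y ⟶ X)
  w₁ : j ≫ ψ = 𝟙 B ≫ i
  w₂ : ψ ≫ p = q ≫ a

lemma nonempty_pushData (h : triangleConflations P i p) (g : B ⟶ B') :
    Nonempty (PushData h g) := by
  obtain ⟨Y, j, q, hj, hγ⟩ := exists_conf (conn h ≫ g.hom⟦(1 : ℤ)⟧')
  obtain ⟨ψ, h₁, h₂⟩ := exists_middle h hj g (𝟙 A) (by simpa using hγ)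
  exact ⟨⟨Y, j, q, hj, ψ, h₁, h₂⟩⟩

lemma nonempty_pullData (h : triangleConflations P i p) (a : A' ⟶ A) :
    Nonempty (PullData h a) := by
  obtain ⟨Y, j, q, hj, hγ⟩ := exists_conf (a.hom ≫ conn h)
  obtain ⟨ψ, h₁, h₂⟩ := exists_middle hj h (𝟙 B) a (by simpa using hγ.symm)
  exact ⟨⟨Y, j, q, hj, ψ, h₁, h₂⟩⟩

/-- A chosen pushout of a conflation. -/
noncomputable def pushData (h : triangleConflations P i p) (g : B ⟶ B') : PushData h g :=
  (nonempty_pushData h g).some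

/-- A chosen pullback of a conflation. -/
noncomputable def pullData (h : triangleConflations P i p) (a : A' ⟶ A) : PullData h a :=
  (nonempty_pullData h a).some

lemma PushData.conn_eq {h : triangleConflations P i p} {g : B ⟶ B'} (d : PushData h g) :
    conn d.conf = conn h ≫ g.hom⟦(1 : ℤ)⟧' := by
  simpa using conn_natural h d.conf g d.ψ (𝟙 A) d.w₁ d.w₂

lemma PullData.conn_eq {h : triangleConflations P i p} {a : A' ⟶ A} (d : PullData h a) :
    conn d.conf = a.hom ≫ conn h := by
  simpa using (conn_natural d.conf h (𝟙 B) d.ψ a d.w₁ d.w₂).symm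

end

/-- The `(k + 1)`-extensions of `A` by `B` in the exact subcategory `P`. -/
abbrev NExt (P : ObjectProperty C) (A : P.FullSubcategory) (k : ℕ) (B : P.FullSubcategory) :=
  NExtension (triangleConflations P) A k B

open NExtension

lemma exists_ladder_iff_isOver {A : P.FullSubcategory} {k : ℕ} {B B' : P.FullSubcategory}
    (β : B ⟶ B') (E : NExt P A k B) (E' : NExt P A k B') :
    (∃ ψ : E.firstObj ⟶ E'.firstObj, E.firstMap ≫ ψ = β ≫ E'.firstMap ∧ LadderFrom E E' ψ) ↔
      IsOver (𝟙 A) β E E' := by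
  induction E generalizing B' with
  | single i p hc =>
    cases E' with
    | single i' p' hc' =>
    simp [IsOver, LadderFrom, firstObj, firstMap]
  | @splice k B X K i p hc E ih =>
    cases E' with
    | @splice _ _ X' K' i' p' hc' E' =>
    constructor
    · rintro ⟨ψ, h₁, ψ', h₂, h₃⟩
      change X ⟶ X' at ψ
      change i ≫ ψ = β ≫ i' at h₁
      change (p ≫ E.firstMap) ≫ ψ' = ψ ≫ (p' ≫ E'.firstMap) at h₂
      have hm : ∃ j q, ∃ (_ : triangleConflations P E'.firstMap (q : _ ⟶ j)), True := by
        cases E' with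
        | single _ q h => exact ⟨_, q, h, trivial⟩
        | splice _ q h _ => exact ⟨_, q, h, trivial⟩
      obtain ⟨j, q, hq, -⟩ := hm
      obtain ⟨φ, hφ⟩ := conf_desc hc (ψ ≫ p') (by
        apply conf_mono hq
        have hz := conf_zero hc
        rw [assoc, assoc, ← h₂, assoc, reassoc_of% hz, zero_comp, zero_comp])
      refine ⟨ψ, φ, h₁, hφ, (ih φ E').1 ⟨ψ', ?_, h₃⟩⟩
      apply conf_epi hc
      rw [← assoc, h₂, ← assoc, hφ, assoc]
    · rintro ⟨ψ, φ, h₁, h₂, h₃⟩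
      obtain ⟨ψ', h₄, h₅⟩ := (ih φ E').2 h₃
      refine ⟨ψ, h₁, ψ', ?_, h₅⟩
      change (p ≫ E.firstMap) ≫ ψ' = ψ ≫ (p' ≫ E'.firstMap)
      rw [assoc, h₄, ← assoc, ← h₂, assoc]

lemma rel_iff_isOver {A : P.FullSubcategory} {k : ℕ} {B : P.FullSubcategory}
    (E E' : NExt P A k B) : NExtension.Rel E E' ↔ IsOver (𝟙 A) (𝟙 B) E E' := by
  rw [← exists_ladder_iff_isOver]
  simp [NExtension.Rel]

/-- The map `A ⟶ C_k[1] ⟶ ⋯ ⟶ C₁[k] ⟶ B[k+1]` associated to a `(k + 1)`-extension of `A` by `B`,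
the composition of the shifts of the connecting morphisms of its conflations. -/
noncomputable def val {A : P.FullSubcategory} : ∀ {k : ℕ} {B : P.FullSubcategory},
    NExt P A k B → (A.obj ⟶ B.obj⟦((k + 1 : ℕ) : ℤ)⟧)
  | _, _, single _ _ h =>
      (ShiftedHom.mk₀ (0 : ℤ) rfl (𝟙 A.obj)).comp (conn h) (by simp)
  | _, _, splice _ _ h E => ShiftedHom.comp (val E) (conn h) (by push_cast; ring)

lemma val_natural {A A' : P.FullSubcategory} (α : A ⟶ A') {k : ℕ} {B B' : P.FullSubcategory}
    (β : B ⟶ B') (E : NExt P A k B) (E' : NExt P A' k B') (h : IsOver α β E E') :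
    α.hom ≫ val E' = val E ≫ β.hom⟦((k + 1 : ℕ) : ℤ)⟧' := by
  induction E generalizing B' with
  | single i p hc =>
    cases E' with
    | single i' p' hc' =>
    obtain ⟨ψ, h₁, h₂⟩ := h
    have := conn_natural hc hc' β ψ α h₁ h₂
    have h₃ := (shiftFunctorAdd' C (1 : ℤ) 0 ((0 + 1 : ℕ) : ℤ) (by simp)).inv.naturality β.hom
    have h₄ := (shiftFunctorZero' C (0 : ℤ) rfl).inv.naturality α.hom
    simp only [val, ShiftedHom.comp, ShiftedHom.mk₀, id_comp, assoc, Functor.id_map] at h₃ h₄ ⊢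
    rw [← h₃, reassoc_of% h₄, ← Functor.map_comp_assoc, this, Functor.comp_map,
      ← Functor.map_comp_assoc]
  | @splice k B X K i p hc E ih =>
    cases E' with
    | splice i' p' hc' E' =>
    obtain ⟨ψ, φ, h₁, h₂, h₃⟩ := h
    have h₄ := conn_natural hc hc' β ψ φ h₁ h₂
    have h₅ := ih _ _ h₃
    have h₆ := (shiftFunctorAdd' C (1 : ℤ) ((k + 1 : ℕ) : ℤ) ((k + 1 + 1 : ℕ) : ℤ)
      (by push_cast; ring)).inv.naturality β.hom
    simp only [val, ShiftedHom.comp, assoc]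
    rw [← h₆, reassoc_of% h₅, ← Functor.map_comp_assoc, h₄, Functor.comp_map,
      ← Functor.map_comp_assoc]

/-- The map `f_{n,A,B} : Extⁿ(A, B) ⟶ Hom(A, B[n])`. -/
noncomputable def extMap : ∀ (n : ℕ) (A B : P.FullSubcategory),
    YExt (triangleConflations P) n A B → (A.obj ⟶ B.obj⟦(n : ℤ)⟧)
  | 0, _, _, g => ShiftedHom.mk₀ ((0 : ℕ) : ℤ) (by simp) g.down.hom
  | _ + 1, A, B, x => Quot.lift (fun E : NExt P A _ B => val E) (fun E E' h => by
      simpa using (val_natural (𝟙 A) (𝟙 B) E E' ((rel_iff_isOver E E').1 h)).symm) x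

/-! ### The Baer sum -/

/-- The direct sum of two objects of the subcategory. -/
noncomputable def dsum (A A' : P.FullSubcategory) : P.FullSubcategory :=
  ⟨A.obj ⊞ A'.obj, IsDyerSubcategory.ext_closed _
    (binaryBiproductTriangle_distinguished A.obj A'.obj) A.property A'.property⟩

/-- The direct sum of two morphisms of the subcategory. -/
noncomputable def dsumMap {A A' B B' : P.FullSubcategory} (f : A ⟶ B) (f' : A' ⟶ B') :
    dsum A A' ⟶ dsum B B' :=
  P.homMk (biprod.map f.hom f'.hom)

lemma dsumMap_comp {A A' B B' Z Z' : P.FullSubcategory} (f : A ⟶ B) (f' : A' ⟶ B')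
    (g : B ⟶ Z) (g' : B' ⟶ Z') :
    dsumMap f f' ≫ dsumMap g g' = dsumMap (f ≫ g) (f' ≫ g') := by
  ext
  change biprod.map _ _ ≫ biprod.map _ _ = biprod.map _ _
  ext <;> simp

lemma dsumMap_id (A A' : P.FullSubcategory) : dsumMap (𝟙 A) (𝟙 A') = 𝟙 (dsum A A') := by
  ext
  change biprod.map _ _ = 𝟙 (A.obj ⊞ A'.obj)
  ext <;> simp

/-- The diagonal `A ⟶ A ⊕ A`. -/
noncomputable def diagonal (A : P.FullSubcategory) : A ⟶ dsum A A :=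
  P.homMk (biprod.lift (𝟙 A.obj) (𝟙 A.obj))

/-- The codiagonal `B ⊕ B ⟶ B`. -/
noncomputable def codiagonal (B : P.FullSubcategory) : dsum B B ⟶ B :=
  P.homMk (biprod.desc (𝟙 B.obj) (𝟙 B.obj))

lemma dsum_conf {B X A B' X' A' : P.FullSubcategory} {i : B ⟶ X} {p : X ⟶ A} {i' : B' ⟶ X'}
    {p' : X' ⟶ A'} (h : triangleConflations P i p) (h' : triangleConflations P i' p') :
    triangleConflations P (dsumMap i i') (dsumMap p p') := by
  obtain ⟨γ, hγ⟩ := h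
  obtain ⟨γ', hγ'⟩ := h'
  exact biprod_distinguished hγ hγ'

/-- The direct sum of two extensions. -/
noncomputable def extSum {A A' : P.FullSubcategory} : ∀ {k : ℕ} {B B' : P.FullSubcategory},
    NExt P A k B → NExt P A' k B' → NExt P (dsum A A') k (dsum B B')
  | _, _, _, single i p h, single i' p' h' =>
      single (dsumMap i i') (dsumMap p p') (dsum_conf h h')
  | _, _, _, splice i p h E, splice i' p' h' E' =>
      splice (dsumMap i i') (dsumMap p p') (dsum_conf h h') (extSum E E')

lemma extSum_isOver {A₁ A₁' A₂ A₂' : P.FullSubcategory} {α : A₁ ⟶ A₂} {α' : A₁' ⟶ A₂'} {k : ℕ}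
    {B₁ B₁' B₂ B₂' : P.FullSubcategory} {β : B₁ ⟶ B₂} {β' : B₁' ⟶ B₂'}
    {E₁ : NExt P A₁ k B₁} {E₁' : NExt P A₁' k B₁'} {E₂ : NExt P A₂ k B₂} {E₂' : NExt P A₂' k B₂'}
    (h : IsOver α β E₁ E₂) (h' : IsOver α' β' E₁' E₂') :
    IsOver (dsumMap α α') (dsumMap β β') (extSum E₁ E₁') (extSum E₂ E₂') := by
  induction E₁ generalizing B₂ B₁' B₂' with
  | single i p hc =>
    cases E₁' with
    | single _ _ _ =>
    cases E₂ with
    | single _ _ _ =>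
    cases E₂' with
    | single _ _ _ =>
    obtain ⟨ψ, h₁, h₂⟩ := h
    obtain ⟨ψ', h₁', h₂'⟩ := h'
    exact ⟨dsumMap ψ ψ', by rw [dsumMap_comp, dsumMap_comp, h₁, h₁'],
      by rw [dsumMap_comp, dsumMap_comp, h₂, h₂']⟩
  | splice i p hc E ih =>
    cases E₁' with
    | splice _ _ _ _ =>
    cases E₂ with
    | splice _ _ _ _ =>
    cases E₂' with
    | splice _ _ _ _ =>
    obtain ⟨ψ, φ, h₁, h₂, h₃⟩ := h
    obtain ⟨ψ', φ', h₁', h₂', h₃'⟩ := h'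
    exact ⟨dsumMap ψ ψ', dsumMap φ φ', by rw [dsumMap_comp, dsumMap_comp, h₁, h₁'],
      by rw [dsumMap_comp, dsumMap_comp, h₂, h₂'], ih h₃ h₃'⟩

/-- The product `g · E` of an extension `E` of `A` by `B` with `g : B ⟶ B'`: the first conflation
`B ⟶ X₁ ⟶ C₁` is replaced by its pushout `B' ⟶ g · X₁ ⟶ C₁`. -/
noncomputable def push {A : P.FullSubcategory} : ∀ {k : ℕ} {B B' : P.FullSubcategory},
    (B ⟶ B') → NExt P A k B → NExt P A k B'
  | _, _, _, g, single _ _ h => single (pushData h g).j (pushData h g).q (pushData h g).conf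
  | _, _, _, g, splice _ _ h E => splice (pushData h g).j (pushData h g).q (pushData h g).conf E

/-- The product `E · a` of an extension `E` of `A` by `B` with `a : A' ⟶ A`: the last conflation
`C_k ⟶ X_{k+1} ⟶ A` is replaced by its pullback along `a`. -/
noncomputable def pull {A A' : P.FullSubcategory} (a : A' ⟶ A) :
    ∀ {k : ℕ} {B : P.FullSubcategory}, NExt P A k B → NExt P A' k B
  | _, _, single _ _ h => single (pullData h a).j (pullData h a).q (pullData h a).conf
  | _, _, splice i p h E => splice i p h (pull a E)

lemma isOver_push {A : P.FullSubcategory} {k : ℕ} {B B' : P.FullSubcategory} (g : B ⟶ B')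
    (E : NExt P A k B) : IsOver (𝟙 A) g E (push g E) := by
  cases E with
  | single i p h => exact ⟨_, (pushData h g).w₁, (pushData h g).w₂⟩
  | splice i p h E => exact ⟨_, 𝟙 _, (pushData h g).w₁, (pushData h g).w₂, .refl _⟩

lemma isOver_pull {A A' : P.FullSubcategory} (a : A' ⟶ A) {k : ℕ} {B : P.FullSubcategory}
    (E : NExt P A k B) : IsOver a (𝟙 B) (pull a E) E := by
  induction E with
  | single i p h => exact ⟨_, (pullData h a).w₁, (pullData h a).w₂⟩
  | splice i p h E ih => exact ⟨𝟙 _, 𝟙 _, by simp, by simp, ih⟩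

lemma push_isOver {A A' : P.FullSubcategory} {α : A ⟶ A'} {k : ℕ} {B B' : P.FullSubcategory}
    {g : B ⟶ B'} {E : NExt P A k B} {G : NExt P A' k B'} (h : IsOver α g E G) :
    IsOver α (𝟙 B') (push g E) G := by
  cases E with
  | single i p hc =>
    cases G with
    | single j q hd =>
    obtain ⟨ψ, h₁, h₂⟩ := h
    exact exists_middle (pushData hc g).conf hd _ _
      (by simpa [(pushData hc g).conn_eq] using conn_natural hc hd g ψ α h₁ h₂)
  | splice i p hc E =>
    cases G with
    | splice j q hd G =>
    obtain ⟨ψ, φ, h₁, h₂, h₃⟩ := h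
    obtain ⟨θ, h₄, h₅⟩ := exists_middle (pushData hc g).conf hd (𝟙 _) φ
      (by simpa [(pushData hc g).conn_eq] using conn_natural hc hd g ψ φ h₁ h₂)
    exact ⟨θ, φ, h₄, h₅, h₃⟩

lemma pull_isOver {A A' : P.FullSubcategory} {a : A' ⟶ A} {k : ℕ} {B B' : P.FullSubcategory}
    {β : B' ⟶ B} {E : NExt P A k B} {G : NExt P A' k B'} (h : IsOver a β G E) :
    IsOver (𝟙 A') β G (pull a E) := by
  induction G generalizing B with
  | single j q hd =>
    cases E with
    | single i p hc =>
    obtain ⟨ψ, h₁, h₂⟩ := h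
    exact exists_middle hd (pullData hc a).conf _ _
      (by simpa [(pullData hc a).conn_eq] using conn_natural hd hc β ψ a h₁ h₂)
  | splice j q hd G ih =>
    cases E with
    | splice i p hc E =>
    obtain ⟨ψ, φ, h₁, h₂, h₃⟩ := h
    exact ⟨ψ, φ, h₁, h₂, ih h₃⟩

/-- The Baer sum `∇ · ((E ⊕ E') · Δ)` of two extensions. -/
noncomputable def baerSum {A : P.FullSubcategory} {k : ℕ} {B : P.FullSubcategory}
    (E E' : NExt P A k B) : NExt P A k B :=
  push (codiagonal B) (pull (diagonal A) (extSum E E'))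

lemma baerSum_rel {A : P.FullSubcategory} {k : ℕ} {B : P.FullSubcategory}
    {E₁ E₁' E₂ E₂' : NExt P A k B} (h : IsOver (𝟙 A) (𝟙 B) E₁ E₂)
    (h' : IsOver (𝟙 A) (𝟙 B) E₁' E₂') : NExtension.Rel (baerSum E₁ E₁') (baerSum E₂ E₂') := by
  rw [rel_iff_isOver]
  have h₁ := extSum_isOver h h'
  rw [dsumMap_id, dsumMap_id] at h₁
  have h₂ := (isOver_pull (diagonal A) (extSum E₁ E₁')).comp h₁
  rw [comp_id, comp_id] at h₂
  have h₃ := (pull_isOver h₂).comp (isOver_push (codiagonal B) _)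
  rw [comp_id, id_comp] at h₃
  exact push_isOver h₃

/-- The addition on `Extⁿ(A, B)`: addition of morphisms for `n = 0`, the Baer sum for `n > 0`. -/
noncomputable def extAdd : ∀ (n : ℕ) (A B : P.FullSubcategory),
    YExt (triangleConflations P) n A B → YExt (triangleConflations P) n A B →
      YExt (triangleConflations P) n A B
  | 0, _, _, g, g' => ULift.up (g.down + g'.down)
  | _ + 1, _, _, x, y => Quot.map₂ baerSum
      (fun E _ _ h => baerSum_rel (.refl E) ((rel_iff_isOver _ _).1 h))
      (fun _ _ E h => baerSum_rel ((rel_iff_isOver _ _).1 h) (.refl E)) x y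

noncomputable instance (n : ℕ) (A B : P.FullSubcategory) :
    Add (YExt (triangleConflations P) n A B) := ⟨extAdd n A B⟩

variable (P) in
/-- The ambient triangulated category has all the Ext groups of `P`: the map
`f_{n,A,B} : Extⁿ(A, B) ⟶ Hom(A, B[n])` is an isomorphism of groups for all `n`, `A` and `B`. -/
def HasAllExtGroups : Prop :=
  ∀ (n : ℕ) (A B : P.FullSubcategory),
    ∃ e : YExt (triangleConflations P) n A B ≃+ (A.obj ⟶ B.obj⟦(n : ℤ)⟧),
      ∀ x, e x = extMap n A B x

end Dyer

/-- The heart of a t-structure satisfies the conditions of `IsDyerSubcategory`. -/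
instance (t : TStructure C) : IsDyerSubcategory t.heart where
  exists_zero := by
    have := t.isLE_of_isZero (isZero_zero C) 0
    have := t.isGE_of_isZero (isZero_zero C) 0
    exact ⟨_, isZero_zero C, (t.mem_heart_iff _).2 ⟨inferInstance, inferInstance⟩⟩
  ext_closed T hT h₁ h₃ := by
    obtain ⟨_, _⟩ := (t.mem_heart_iff _).1 h₁
    obtain ⟨_, _⟩ := (t.mem_heart_iff _).1 h₃
    exact (t.mem_heart_iff _).2 ⟨t.isLE₂ T hT 0 inferInstance inferInstance,
      t.isGE₂ T hT 0 inferInstance inferInstance⟩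
  hom_zero {A B} hA hB f := by
    obtain ⟨_, _⟩ := (t.mem_heart_iff _).1 hA
    obtain ⟨_, _⟩ := (t.mem_heart_iff _).1 hB
    have := t.isGE_shift B 0 (-1) 1
    exact t.zero f 0 1

end Triangulated

end ExtGroups

/-! The maps f_n are additive because the map `val` from extensions to Hom(A, B[n]) is natural
(`val_baerSum`), and f_0 is bijective because the subcategory is full. So the criterion is about
bijectivity for n ≥ 1. Any morphism A ⟶ B[1] is the connecting morphism of a conflation, since the
subcategory is closed under extensions. Hence the image of f_n consists exactly of the morphisms
that factor through shifted objects of the subcategory, and surjectivity of f_n is the factorization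
property (`extMap_surjective_iff_factorsThrough`).

The substance is that surjectivity in all degrees forces injectivity (`quot_eq_of_val_eq`). Write
two extensions with the same image as splices γ · F and γ' · F', with γ : K ⟶ B[1] and γ' : K' ⟶
B[1]. The homotopy pullback Z of γ and γ' is an extension of K ⊕ K' by B, so it lies in the
subcategory, and the images of F and F' lift to one morphism A ⟶ Z[n-1] (`exists_pullback`). By
surjectivity this morphism comes from an extension G of A by Z. By induction F and F' are equivalent
to the pushouts of G along a : Z ⟶ K and a' : Z ⟶ K', so both splices are equivalent to the splice
of G with the class a ≫ γ = a' ≫ γ'.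

For a heart of dimension at most 1 the criterion is immediate: nothing is required for n = 1, and
Hom(A, B[n]) = 0 for n ≥ 2. The equality of dimensions then needs the conflations of a heart to be
its short exact sequences (`shortExactSequences_heart`), whose main point is that the cone of a
monomorphism of the heart lies in the heart. -/

namespace ExtGroups

open NExtension

/-! ### Shifted morphisms, zero factorizations and vanishing above the dimension -/

section Shift

variable {C : Type u} [Category.{v} C] [HasShift C ℤ]

/-- The shift functor is full, so each step of a factorization is the shift of a degree one
morphism; such a morphism can then be realized by a conflation. -/
lemma exists_conn_shift {n : ℕ} {K B : C} (h : K⟦(n : ℤ)⟧ ⟶ B⟦((n + 1 : ℕ) : ℤ)⟧) :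
    ∃ γ : K ⟶ B⟦(1 : ℤ)⟧, ∀ {A : C} (g : A ⟶ K⟦(n : ℤ)⟧),
      ShiftedHom.comp g γ (by push_cast; ring) = g ≫ h := by
  let e := shiftFunctorAdd' C (1 : ℤ) (n : ℤ) ((n + 1 : ℕ) : ℤ) (by push_cast; ring)
  refine ⟨(shiftFunctor C (n : ℤ)).preimage (h ≫ e.hom.app B), fun g => ?_⟩
  rw [ShiftedHom.comp, Functor.map_preimage, assoc, Iso.hom_inv_id_app, comp_id]

variable [Preadditive C]

lemma factorsThrough_zero {P : ObjectProperty C} {A B : C} (hB : P B) (n : ℕ) :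
    FactorsThrough P A (n + 1) B 0 := by
  induction n with
  | zero => exact .one _
  -- All intermediate objects are taken to be `B` itself.
  | succ n ih => simpa using FactorsThrough.step hB 0 ih (0 : _ ⟶ B⟦((n + 1 + 1 : ℕ) : ℤ)⟧)

lemma eq_zero_of_dimIn_lt {P : ObjectProperty C} {n : ℤ}
    (h : dimIn P < ((n : WithTop ℤ) : WithBot (WithTop ℤ))) {A B : C} (hA : P A) (hB : P B)
    (f : A ⟶ B⟦n⟧) : f = 0 := by
  by_contra hf
  exact h.not_ge (le_iSup₂_of_le n ⟨A, B, hA, hB, f, hf⟩ le_rfl)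

end Shift

section Dyer

variable {C : Type u} [Category.{v} C] [Preadditive C] [HasZeroObject C] [HasShift C ℤ]
  [∀ n : ℤ, (shiftFunctor C n).Additive] [Pretriangulated C]
  {P : ObjectProperty C}

/-! ### Compatibility of the map to `Hom(A, B[n])` with the algebraic operations -/

lemma val_single {A B X : P.FullSubcategory} {i : B ⟶ X} {p : X ⟶ A}
    (h : triangleConflations P i p) :
    val (single i p h) = (conn h : A.obj ⟶ B.obj⟦(1 : ℤ)⟧) :=
  ShiftedHom.mk₀_id_comp (0 : ℤ) rfl (conn h)

lemma factorsThrough_val {A B : P.FullSubcategory} {k : ℕ} (E : NExt P A k B) :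
    FactorsThrough P A.obj (k + 1) B.obj (val E) := by
  induction E with
  | single i p h => exact .one _
  | @splice k B X K i p h E ih => exact .step K.property _ ih _

variable [IsDyerSubcategory P]

lemma val_push {A B B' : P.FullSubcategory} {k : ℕ} (g : B ⟶ B') (E : NExt P A k B) :
    val (push g E) = val E ≫ g.hom⟦((k + 1 : ℕ) : ℤ)⟧' := by
  simpa using val_natural (𝟙 A) g E _ (isOver_push g E)

lemma val_pull {A A' B : P.FullSubcategory} {k : ℕ} (a : A' ⟶ A) (E : NExt P A k B) :
    val (pull a E) = a.hom ≫ val E := by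
  simpa using (val_natural a (𝟙 B) _ E (isOver_pull a E)).symm

/-- The first inclusion `A ⟶ A ⊕ A'`. -/
noncomputable def dsumInl (A A' : P.FullSubcategory) : A ⟶ dsum A A' := P.homMk biprod.inl

/-- The second inclusion `A' ⟶ A ⊕ A'`. -/
noncomputable def dsumInr (A A' : P.FullSubcategory) : A' ⟶ dsum A A' := P.homMk biprod.inr

lemma dsumInl_dsumMap {A A' B B' : P.FullSubcategory} (f : A ⟶ B) (f' : A' ⟶ B') :
    dsumInl A A' ≫ dsumMap f f' = f ≫ dsumInl B B' := by
  ext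
  exact biprod.inl_map _ _

lemma dsumInr_dsumMap {A A' B B' : P.FullSubcategory} (f : A ⟶ B) (f' : A' ⟶ B') :
    dsumInr A A' ≫ dsumMap f f' = f' ≫ dsumInr B B' := by
  ext
  exact biprod.inr_map _ _

lemma isOver_dsumInl {A A' B B' : P.FullSubcategory} {k : ℕ} (E : NExt P A k B)
    (E' : NExt P A' k B') : IsOver (dsumInl A A') (dsumInl B B') E (extSum E E') := by
  induction E generalizing B' with
  | single i p h =>
    cases E' with
    | single i' p' h' =>
    exact ⟨dsumInl _ _, (dsumInl_dsumMap _ _).symm, dsumInl_dsumMap _ _⟩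
  | splice i p h E ih =>
    cases E' with
    | splice i' p' h' E' =>
    exact ⟨dsumInl _ _, dsumInl _ _, (dsumInl_dsumMap _ _).symm, dsumInl_dsumMap _ _, ih E'⟩

lemma isOver_dsumInr {A A' B B' : P.FullSubcategory} {k : ℕ} (E : NExt P A k B)
    (E' : NExt P A' k B') : IsOver (dsumInr A A') (dsumInr B B') E' (extSum E E') := by
  induction E generalizing B' with
  | single i p h =>
    cases E' with
    | single i' p' h' =>
    exact ⟨dsumInr _ _, (dsumInr_dsumMap _ _).symm, dsumInr_dsumMap _ _⟩
  | splice i p h E ih =>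
    cases E' with
    | splice i' p' h' E' =>
    exact ⟨dsumInr _ _, dsumInr _ _, (dsumInr_dsumMap _ _).symm, dsumInr_dsumMap _ _, ih E'⟩

lemma diagonal_hom_eq (A : P.FullSubcategory) :
    (diagonal A).hom = (dsumInl A A).hom + (dsumInr A A).hom := by
  have h : biprod.lift (𝟙 A.obj) (𝟙 A.obj) = biprod.inl + biprod.inr := by
    apply biprod.hom_ext <;> simp
  exact h

lemma dsumInl_codiagonal (B : P.FullSubcategory) :
    (dsumInl B B).hom ≫ (codiagonal B).hom = 𝟙 B.obj :=
  biprod.inl_desc _ _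

lemma dsumInr_codiagonal (B : P.FullSubcategory) :
    (dsumInr B B).hom ≫ (codiagonal B).hom = 𝟙 B.obj :=
  biprod.inr_desc _ _

/-- The connecting morphisms of a direct sum of conflations are never computed: naturality along the
two inclusions determines `val (extSum E E')` on each summand, and the diagonal is the sum of the
inclusions while each inclusion followed by the codiagonal is the identity. -/
lemma val_baerSum {A B : P.FullSubcategory} {k : ℕ} (E E' : NExt P A k B) :
    val (baerSum E E') = val E + val E' := by
  have h₁ := val_natural _ _ _ _ (isOver_dsumInl E E')
  have h₂ := val_natural _ _ _ _ (isOver_dsumInr E E')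
  rw [baerSum, val_push, val_pull, diagonal_hom_eq, Preadditive.add_comp, h₁, h₂,
    Preadditive.add_comp, assoc, assoc, ← Functor.map_comp, ← Functor.map_comp,
    dsumInl_codiagonal, dsumInr_codiagonal, CategoryTheory.Functor.map_id, comp_id, comp_id]

lemma extMap_add (n : ℕ) (A B : P.FullSubcategory) (x y : YExt (triangleConflations P) n A B) :
    extMap n A B (x + y) = extMap n A B x + extMap n A B y := by
  cases n with
  | zero => exact ShiftedHom.mk₀_add _ _ _ _
  | succ k =>
    induction x using Quot.ind
    induction y using Quot.ind
    exact val_baerSum _ _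

/-! ### Surjectivity -/

lemma exists_extMap_eq {A : P.FullSubcategory} {n : ℕ} {B : C} {g : A.obj ⟶ B⟦(n : ℤ)⟧}
    (h : FactorsThrough P A.obj n B g) (hB : P B) :
    ∃ x : YExt (triangleConflations P) n A ⟨B, hB⟩, extMap n A ⟨B, hB⟩ x = g := by
  induction h with
  | one g =>
    obtain ⟨Y, j, q, hc, hγ⟩ := exists_conf (A := A) (B := ⟨_, hB⟩) g
    exact ⟨Quot.mk _ (single j q hc), (val_single hc).trans hγ⟩
  | @step n K B hK g hg f ih =>
    cases n with
    -- No factorization exists in degree 0, so a step always extends a factorization of positive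
    -- degree.
    | zero => cases hg
    | succ k =>
      obtain ⟨x, hx⟩ := ih hK
      induction x using Quot.ind with
      | mk E =>
      change val E = g at hx
      obtain ⟨γ, hγ⟩ := exists_conn_shift f
      obtain ⟨Y, j, q, hc, hc'⟩ := exists_conf (A := ⟨K, hK⟩) (B := ⟨B, hB⟩) γ
      refine ⟨Quot.mk _ (splice j q hc E), ?_⟩
      change ShiftedHom.comp (val E) (conn hc) _ = _
      rw [hx, hc', hγ]

lemma extMap_surjective_iff_factorsThrough (n : ℕ) (A B : P.FullSubcategory) :
    Function.Surjective (extMap (n + 1) A B) ↔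
      ∀ g, FactorsThrough P A.obj (n + 1) B.obj g := by
  refine ⟨fun h g => ?_, fun h g => exists_extMap_eq (h g) B.property⟩
  obtain ⟨x, rfl⟩ := h g
  induction x using Quot.ind with
  | mk E => exact factorsThrough_val E

/-! ### Injectivity -/

lemma splice_congr {A B X K : P.FullSubcategory} {i : B ⟶ X} {p : X ⟶ K}
    (h : triangleConflations P i p) {k : ℕ} {F F' : NExt P A k K}
    (hF : Quot.mk NExtension.Rel F = Quot.mk NExtension.Rel F') :
    Quot.mk NExtension.Rel (splice i p h F) = Quot.mk NExtension.Rel (splice i p h F') :=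
  congrArg (Quot.map (splice i p h) fun E E' hE => (rel_iff_isOver _ _).2 (by
    exact ⟨𝟙 _, 𝟙 _, by simp, by simp, (rel_iff_isOver E E').1 hE⟩)) hF

/-- Moving a morphism `a : Z ⟶ K` across a splice: `(γ · a) · G = γ · (a · G)`. -/
lemma splice_eq_splice_of_push {A B Y Z X K : P.FullSubcategory} {j : B ⟶ Y} {q : Y ⟶ Z}
    {i : B ⟶ X} {p : X ⟶ K} (hj : triangleConflations P j q) (hi : triangleConflations P i p)
    (a : Z ⟶ K) (hconn : conn hj = a.hom ≫ conn hi) {k : ℕ} (G : NExt P A k Z)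
    (F : NExt P A k K) (hF : Quot.mk NExtension.Rel (push a G) = Quot.mk NExtension.Rel F) :
    Quot.mk NExtension.Rel (splice j q hj G) = Quot.mk NExtension.Rel (splice i p hi F) := by
  -- The intermediate extension is the splice of `i`, `p` with `push a G`.
  refine Eq.trans (Quot.sound ((rel_iff_isOver _ _).2 ?_)) (splice_congr hi hF)
  obtain ⟨ψ, h₁, h₂⟩ := exists_middle hj hi (𝟙 B) a (by simpa using hconn.symm)
  exact ⟨ψ, a, h₁, h₂, isOver_push a G⟩

/-- Exactness of `Hom(A, -)` on the `n`-th shift of a distinguished triangle. -/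
lemma exists_lift_shift (T : Triangle C) (hT : T ∈ distTriang C) (n : ℤ) {A : C}
    (f : A ⟶ T.obj₂⟦n⟧) (hf : f ≫ T.mor₂⟦n⟧' = 0) : ∃ w : A ⟶ T.obj₁⟦n⟧, w ≫ T.mor₁⟦n⟧' = f := by
  obtain ⟨(w : A ⟶ T.obj₁⟦n⟧), (hw : f = w ≫ (n.negOnePow • T.mor₁⟦n⟧'))⟩ :=
    Triangle.coyoneda_exact₂ _ (Triangle.shift_distinguished T hT n) f
      (by
        change f ≫ (n.negOnePow • T.mor₂⟦n⟧') = 0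
        rw [Linear.comp_units_smul, hf, smul_zero])
  -- The shifted triangle carries the sign (-1)^n on its morphisms; it is absorbed into the lift.
  refine ⟨n.negOnePow • w, ?_⟩
  rw [hw]
  rw [Linear.comp_units_smul, Linear.units_smul_comp]

/-- Homotopy pullback of `γ : K ⟶ B[1]` and `γ' : K' ⟶ B[1]`: it belongs to the subcategory, and
any two morphisms `A ⟶ K[n]`, `A ⟶ K'[n]` with the same composition to `B[1][n]` lift to it. -/
lemma exists_pullback {B K K' : P.FullSubcategory} (γ : K.obj ⟶ B.obj⟦(1 : ℤ)⟧)
    (γ' : K'.obj ⟶ B.obj⟦(1 : ℤ)⟧) :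
    ∃ (Z : P.FullSubcategory) (a : Z ⟶ K) (a' : Z ⟶ K'), a.hom ≫ γ = a'.hom ≫ γ' ∧
      ∀ {A : C} {n : ℤ} (f : A ⟶ K.obj⟦n⟧) (f' : A ⟶ K'.obj⟦n⟧), f ≫ γ⟦n⟧' = f' ≫ γ'⟦n⟧' →
        ∃ w : A ⟶ Z.obj⟦n⟧, w ≫ a.hom⟦n⟧' = f ∧ w ≫ a'.hom⟦n⟧' = f' := by
  let δ : K.obj ⊞ K'.obj ⟶ B.obj⟦(1 : ℤ)⟧ := biprod.desc γ (-γ')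
  obtain ⟨Z, j, q, hT⟩ := distinguished_cocone_triangle₂ δ
  have hZ : P Z := IsDyerSubcategory.ext_closed _ hT B.property (dsum K K').property
  have hq : q ≫ δ = 0 := comp_distTriang_mor_zero₂₃ _ hT
  have hδ : δ = biprod.fst ≫ γ - biprod.snd ≫ γ' := by
    apply biprod.hom_ext' <;> simp [δ, Preadditive.comp_sub]
  refine ⟨⟨Z, hZ⟩, P.homMk (q ≫ biprod.fst), P.homMk (q ≫ biprod.snd), ?_, ?_⟩
  · change (q ≫ biprod.fst) ≫ γ = (q ≫ biprod.snd) ≫ γ'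
    rw [hδ, Preadditive.comp_sub, sub_eq_zero] at hq
    simpa using hq
  · intro A n f f' hff'
    let F : A ⟶ (K.obj ⊞ K'.obj)⟦n⟧ := f ≫ biprod.inl⟦n⟧' + f' ≫ biprod.inr⟦n⟧'
    have hF : F ≫ δ⟦n⟧' = 0 := by
      rw [Preadditive.add_comp, assoc, assoc, ← Functor.map_comp, ← Functor.map_comp,
        biprod.inl_desc, biprod.inr_desc, Functor.map_neg, Preadditive.comp_neg, hff',
        add_neg_cancel]
    -- Rotating makes `q` and `δ` the first two morphisms of the triangle.
    obtain ⟨(w : A ⟶ Z⟦n⟧), (hw : w ≫ q⟦n⟧' = F)⟩ :=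
      exists_lift_shift _ (rot_of_distTriang _ hT) n F hF
    refine ⟨w, ?_, ?_⟩
    · change w ≫ (q ≫ biprod.fst)⟦n⟧' = f
      rw [Functor.map_comp, reassoc_of% hw, Preadditive.add_comp, assoc, assoc,
        ← Functor.map_comp, ← Functor.map_comp]
      simp
    · change w ≫ (q ≫ biprod.snd)⟦n⟧' = f'
      rw [Functor.map_comp, reassoc_of% hw, Preadditive.add_comp, assoc, assoc,
        ← Functor.map_comp, ← Functor.map_comp]
      simp

/-- Induction on the length, removing the conflation next to `B`. In length one, equal connecting
morphisms already yield a morphism of conflations over the identities, without the surjectivity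
assumption. -/
lemma quot_eq_of_val_eq {A : P.FullSubcategory}
    (hs : ∀ (k : ℕ) (B : P.FullSubcategory), Function.Surjective (extMap (k + 1) A B))
    {k : ℕ} {B : P.FullSubcategory} (E E' : NExt P A k B) (h : val E = val E') :
    Quot.mk NExtension.Rel E = Quot.mk NExtension.Rel E' := by
  induction k generalizing B with
  | zero =>
    cases E with
    | single i p hc =>
    cases E' with
    | single i' p' hc' =>
    rw [val_single, val_single] at h
    refine Quot.sound ((rel_iff_isOver _ _).2 ?_)
    exact exists_middle hc hc' _ _ (by simpa using h.symm)
  | succ k ih =>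
    cases E with
    | @splice _ _ X K i p hc F =>
    cases E' with
    | @splice _ _ X' K' i' p' hc' F' =>
    obtain ⟨Z, a, a', haa', hZ⟩ := exists_pullback (conn hc) (conn hc')
    -- Both values end with the same isomorphism between the iterated shift and the total shift of
    -- `B`; cancelling it leaves the compatibility required for the lift.
    obtain ⟨w, hw, hw'⟩ := hZ (val F) (val F') (by
      simpa only [val, ShiftedHom.comp, ← assoc, cancel_mono] using h)
    -- This is the only use of surjectivity, in one degree lower than the extensions being compared.
    obtain ⟨G, rfl⟩ : ∃ G : NExt P A k Z, val G = w := by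
      obtain ⟨x, rfl⟩ := hs k Z w
      induction x using Quot.ind with
      | mk G => exact ⟨G, rfl⟩
    obtain ⟨Y, j, q, hj, hγ⟩ := exists_conf (a.hom ≫ conn hc)
    rw [← splice_eq_splice_of_push hj hc a hγ G F (ih _ _ ((val_push a G).trans hw)),
      ← splice_eq_splice_of_push hj hc' a' (hγ.trans haa') G F'
        (ih _ _ ((val_push a' G).trans hw'))]

/-! ### The factorization criterion -/

lemma extMap_zero_bijective (A B : P.FullSubcategory) : Function.Bijective (extMap 0 A B) := by
  let e : YExt (triangleConflations P) 0 A B ≃ (A.obj ⟶ B.obj⟦((0 : ℕ) : ℤ)⟧) :=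
    Equiv.ulift.trans (P.fullyFaithfulι.homEquiv.trans (ShiftedHom.homEquiv ((0 : ℕ) : ℤ) (by simp)))
  exact e.bijective

lemma hasAllExtGroups_iff_bijective :
    HasAllExtGroups P ↔ ∀ n A B, Function.Bijective (extMap (P := P) n A B) := by
  refine ⟨fun h n A B => ?_, fun h n A B => ?_⟩
  · obtain ⟨e, he⟩ := h n A B
    rw [← funext he]
    exact e.bijective
  · exact ⟨AddEquiv.mk (Equiv.ofBijective _ (h n A B)) (extMap_add n A B), fun _ => rfl⟩

theorem hasAllExtGroups_iff_factorsThrough :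
    HasAllExtGroups P ↔ ∀ (n : ℕ), 1 ≤ n → ∀ (A B : C), P A → P B → ∀ g : A ⟶ B⟦(n : ℤ)⟧,
      FactorsThrough P A n B g := by
  rw [hasAllExtGroups_iff_bijective]
  refine ⟨fun h n hn A B hA hB => ?_, fun h => ?_⟩
  · obtain ⟨k, rfl⟩ := Nat.exists_eq_add_of_le' hn
    exact (extMap_surjective_iff_factorsThrough k ⟨A, hA⟩ ⟨B, hB⟩).1 (h _ _ _).2
  · have hs (k : ℕ) (A B : P.FullSubcategory) : Function.Surjective (extMap (k + 1) A B) :=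
      (extMap_surjective_iff_factorsThrough k A B).2
        (h _ (Nat.le_add_left 1 k) _ _ A.property B.property)
    rintro (_ | k) A B
    · exact extMap_zero_bijective A B
    · refine ⟨fun x y => ?_, hs k A B⟩
      induction x using Quot.ind
      induction y using Quot.ind
      exact quot_eq_of_val_eq (hs · A ·) _ _

end Dyer

/-! ### Hearts of t-structures -/

section Heart

variable {C : Type u} [Category.{v} C] [Preadditive C] [HasZeroObject C] [HasShift C ℤ]
  [∀ n : ℤ, (shiftFunctor C n).Additive] [Pretriangulated C]

/-! ### Conflations are short exact -/

section Conflations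

variable {P : ObjectProperty C} {B X A : P.FullSubcategory} {i : B ⟶ X} {p : X ⟶ A}

lemma conf_lift (h : triangleConflations P i p) {Z : P.FullSubcategory} (f : Z ⟶ X)
    (hf : f ≫ p = 0) : ∃ g : Z ⟶ B, g ≫ i = f := by
  obtain ⟨γ, hγ⟩ := h
  obtain ⟨g, hg⟩ := Triangle.coyoneda_exact₂ _ hγ f.hom (congrArg (·.hom) hf)
  exact ⟨P.homMk g, by ext; exact hg.symm⟩

variable [IsDyerSubcategory P]

/-- The long exact Hom sequences, with the vanishing of negative Homs, make `i` a kernel of `p` and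
`p` a cokernel of `i`. Since the subcategory need not be abelian, homology data with zero homology
are given explicitly. -/
lemma shortExact_of_triangleConflation (h : triangleConflations P i p) :
    shortExactSequences P.FullSubcategory i p := by
  have : Mono i := ⟨fun _ _ => conf_mono h⟩
  have : Epi p := ⟨fun _ _ => conf_epi h⟩
  obtain ⟨Z, hZ, hZP⟩ := IsDyerSubcategory.exists_zero (P := P)
  let O : P.FullSubcategory := ⟨Z, hZP⟩
  have hO : IsZero O := by
    rw [IsZero.iff_id_eq_zero]
    ext
    exact hZ.eq_of_src _ _
  have hi : IsLimit (KernelFork.ofι i (conf_zero h)) :=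
    KernelFork.IsLimit.ofι' _ _ fun f hf =>
      ⟨(conf_lift h f hf).choose, (conf_lift h f hf).choose_spec⟩
  have hp : IsColimit (CokernelCofork.ofπ p (conf_zero h)) :=
    CokernelCofork.IsColimit.ofπ' _ _ fun f hf =>
      ⟨(conf_desc h f hf).choose, (conf_desc h f hf).choose_spec.symm⟩
  have hi' : Epi (hi.lift (KernelFork.ofι i (conf_zero h))) := by
    have : hi.lift (KernelFork.ofι i (conf_zero h)) = 𝟙 B := by
      rw [← cancel_mono i]
      exact (hi.fac _ WalkingParallelPair.zero).trans (id_comp i).symm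
    rw [this]
    exact ⟨fun _ _ hf => (id_comp _).symm.trans (hf.trans (id_comp _))⟩
  have hp' : Mono (hp.desc (CokernelCofork.ofπ p (conf_zero h))) := by
    have : hp.desc (CokernelCofork.ofπ p (conf_zero h)) = 𝟙 A := by
      rw [← cancel_epi p]
      exact (hp.fac _ WalkingParallelPair.one).trans (comp_id p).symm
    rw [this]
    exact ⟨fun _ _ hf => (comp_id _).symm.trans (hf.trans (comp_id _))⟩
  let S := ShortComplex.mk i p (conf_zero h)
  let H : S.HomologyData :=
    { left :=
        { K := B, H := O, i := i, π := 0, wi := conf_zero h, hi := hi, wπ := comp_zero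
          hπ := CokernelCofork.IsColimit.ofEpiOfIsZero _ hi' hO }
      right :=
        { Q := A, H := O, p := p, ι := 0, wp := conf_zero h, hp := hp, wι := zero_comp
          hι := KernelFork.IsLimit.ofMonoOfIsZero _ hp' hO }
      iso := Iso.refl O
      comm := by simpa using (conf_zero h).symm }
  exact ⟨conf_zero h, { exact := ⟨H, hO⟩, mono_f := ‹_›, epi_g := ‹_› }⟩

end Conflations

/-! ### Short exact sequences of a heart are conflations -/

variable (t : TStructure C)

/-- The cone `Y` lies in degrees -1 and 0, and its degree -1 part `W`, shifted by -1, plays the role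
of the kernel of `i`. Injectivity of `i` kills this part, so `Y` is in the heart. -/
lemma exists_triangleConflation_of_mono {B X : t.heart.FullSubcategory} (i : B ⟶ X) [Mono i] :
    ∃ (Y : t.heart.FullSubcategory) (q : X ⟶ Y), triangleConflations t.heart i q := by
  obtain ⟨_, _⟩ := (t.mem_heart_iff _).1 B.property
  obtain ⟨_, _⟩ := (t.mem_heart_iff _).1 X.property
  obtain ⟨Y, q, d, hT⟩ := distinguished_cocone_triangle i.hom
  have hT' := rot_of_distTriang _ hT
  have := t.isLE_shift B.obj 0 1 (-1)
  have := t.isGE_shift B.obj 0 1 (-1)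
  have hY : t.IsLE Y 0 := t.isLE₂ _ hT' 0 ‹_› (t.isLE_of_le (B.obj⟦(1 : ℤ)⟧) (-1) 0)
  have hY' : t.IsGE Y (-1) := t.isGE₂ _ hT' (-1) (t.isGE_of_ge X.obj (-1) 0) ‹_›
  obtain ⟨W, Q, hW, hQ, u, r, e, hU⟩ := t.exists_triangle Y (-1) 0 (by simp)
  have hU' := inv_rot_of_distTriang _ hU
  rw [t.le_iff_isLE] at hW
  rw [t.ge_iff_isGE] at hQ
  have hQ' : t.IsGE (Q⟦(-1 : ℤ)⟧) 1 := t.isGE_shift Q 0 (-1) 1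
  have hW' : t.IsGE W (-1) := t.isGE₂ _ hU' (-1) (t.isGE_of_ge (Q⟦(-1 : ℤ)⟧) (-1) 1) hY'
  let K : t.heart.FullSubcategory := ⟨W⟦(-1 : ℤ)⟧,
    (t.mem_heart_iff _).2 ⟨t.isLE_shift W (-1) (-1) 0, t.isGE_shift W (-1) (-1) 0⟩⟩
  let α : K.obj⟦(1 : ℤ)⟧ ≅ W := shiftNegShift W 1
  -- This morphism corresponds to some `k : K ⟶ B` in the heart with `k ≫ i = 0`, and `i` is a
  -- monomorphism.
  have hud : u ≫ d = 0 := by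
    obtain ⟨k, hk⟩ := (shiftFunctor C (1 : ℤ)).map_surjective (α.hom ≫ u ≫ d)
    have hdi : d ≫ i.hom⟦(1 : ℤ)⟧' = 0 := comp_distTriang_mor_zero₃₁ _ hT
    have hk0 : t.heart.homMk k = (0 : K ⟶ B) := by
      rw [← cancel_mono i, zero_comp]
      ext
      apply (shiftFunctor C (1 : ℤ)).map_injective
      change (k ≫ i.hom)⟦(1 : ℤ)⟧' = (0 : K.obj ⟶ X.obj)⟦(1 : ℤ)⟧'
      rw [Functor.map_comp, hk, assoc, assoc, hdi, comp_zero, comp_zero, Functor.map_zero]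
    have hk0' : k = 0 := congrArg (·.hom) hk0
    rw [← cancel_epi α.hom, ← hk, hk0', Functor.map_zero, comp_zero]
  have hu : u = 0 := by
    -- So `u` factors through `X`, which is in degrees ≥ 0, while `W` is in degrees ≤ -1.
    obtain ⟨w, hw⟩ := Triangle.coyoneda_exact₃ _ hT u hud
    have hw0 : w = 0 := t.zero_of_isLE_of_isGE w (-1) 0 (by simp) hW ‹_›
    rw [hw, hw0]
    exact zero_comp
  have hW0 : IsZero W := by
    rw [IsZero.iff_id_eq_zero]
    -- Since `u = 0`, the identity of `W` factors through `Q[-1]`, which is in degrees ≥ 1.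
    obtain ⟨x, hx⟩ := Triangle.coyoneda_exact₂ _ hU' (𝟙 W) ((id_comp u).trans hu)
    have hx0 : x = 0 := t.zero_of_isLE_of_isGE x (-1) 1 (by simp) hW hQ'
    rw [hx, hx0, zero_comp]
    rfl
  have : IsIso r := (Triangle.isZero₁_iff_isIso₂ _ hU).1 hW0
  exact ⟨⟨Y, (t.mem_heart_iff _).2 ⟨hY, t.isGE_of_iso (asIso r).symm 0⟩⟩, t.heart.homMk q, d, hT⟩

/-- Every monomorphism is the kernel of its cone map `q`; if it is also an epimorphism then `q = 0`
and the identity of `X` lifts through it. Balancedness is what lets a short exact sequence be used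
as a cokernel sequence below. -/
lemma balanced_heart : Balanced t.heart.FullSubcategory where
  isIso_of_mono_of_epi {B X} i _ _ := by
    obtain ⟨Y, q, h⟩ := exists_triangleConflation_of_mono t i
    have hq : q = 0 := by rw [← cancel_epi i, conf_zero h, comp_zero]
    obtain ⟨s, hs⟩ := conf_lift h (𝟙 X) (by rw [hq, comp_zero])
    exact ⟨s, by rw [← cancel_mono i, assoc, hs, comp_id, id_comp], hs⟩

/-- Both `p` and the cone map `q` are cokernels of `i`, so the distinguished triangle of `q` is
transported along the resulting isomorphism `A ≅ Y`. -/
lemma triangleConflation_of_shortExact {B X A : t.heart.FullSubcategory} {i : B ⟶ X} {p : X ⟶ A}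
    (h : shortExactSequences t.heart.FullSubcategory i p) : triangleConflations t.heart i p := by
  obtain ⟨w, hS⟩ := h
  have := balanced_heart t
  have : Mono i := hS.mono_f
  have : Epi p := hS.epi_g
  obtain ⟨Y, q, hq⟩ := exists_triangleConflation_of_mono t i
  obtain ⟨(l : A ⟶ Y), (hl : p ≫ l = q)⟩ := hS.exact.desc' q (conf_zero hq)
  obtain ⟨g, hg⟩ := conf_desc hq p w
  have hlg : l ≫ g = 𝟙 A := by
    rw [← cancel_epi p, comp_id, reassoc_of% hl, ← hg]
  have hgl : g ≫ l = 𝟙 Y := by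
    apply conf_epi hq
    rw [comp_id, ← assoc, ← hg, hl]
  let e : A.obj ≅ Y.obj := ⟨l.hom, g.hom, congrArg (·.hom) hlg, congrArg (·.hom) hgl⟩
  obtain ⟨d, hd⟩ := hq
  refine ⟨l.hom ≫ d, isomorphic_distinguished _ hd _ ?_⟩
  refine Triangle.isoMk _ _ (Iso.refl _) (Iso.refl _) e ?_ ?_ ?_
  · exact (comp_id _).trans (id_comp _).symm
  · exact (congrArg (·.hom) hl).trans (id_comp _).symm
  · change (l.hom ≫ d) ≫ (𝟙 B.obj)⟦(1 : ℤ)⟧' = l.hom ≫ d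
    rw [CategoryTheory.Functor.map_id, comp_id]

lemma shortExactSequences_heart :
    shortExactSequences t.heart.FullSubcategory = triangleConflations t.heart := by
  funext B X A i p
  exact propext ⟨triangleConflation_of_shortExact t, shortExact_of_triangleConflation⟩

/-! ### Comparison of dimensions -/

lemma extDim_eq_dimIn_of_hasAllExtGroups (h : HasAllExtGroups t.heart) :
    extDim (triangleConflations t.heart) = dimIn t.heart := by
  apply le_antisymm
  · refine iSup₂_le fun n ⟨A, B, _⟩ => ?_
    obtain ⟨e, -⟩ := h n A B
    have := e.symm.toEquiv.nontrivial
    obtain ⟨f, hf⟩ := exists_ne (0 : A.obj ⟶ B.obj⟦(n : ℤ)⟧)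
    exact le_iSup₂_of_le (n : ℤ) ⟨_, _, A.property, B.property, f, hf⟩ le_rfl
  · refine iSup₂_le fun n ⟨A, B, hA, hB, f, hf⟩ => ?_
    -- `dimIn` ranges over all integers and `extDim` over naturals only; for `n < 0` the shift
    -- `B[n]` is in degrees ≥ 1, so there are no nonzero morphisms.
    obtain hn | hn := lt_or_ge n 0
    · obtain ⟨_, _⟩ := (t.mem_heart_iff _).1 hA
      obtain ⟨_, _⟩ := (t.mem_heart_iff _).1 hB
      have := t.isGE_shift B 0 n (-n)
      exact (hf (t.zero f 0 (-n))).elim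
    · lift n to ℕ using hn
      obtain ⟨e, -⟩ := h n ⟨A, hA⟩ ⟨B, hB⟩
      have : Nontrivial (A ⟶ B⟦(n : ℤ)⟧) := ⟨f, 0, hf⟩
      exact le_iSup₂_of_le n ⟨⟨A, hA⟩, ⟨B, hB⟩, e.toEquiv.nontrivial⟩ le_rfl

theorem hasAllExtGroups_of_dimIn_le_one (ht : dimIn t.heart ≤ 1) : HasAllExtGroups t.heart := by
  rw [hasAllExtGroups_iff_factorsThrough]
  intro n hn A B hA hB g
  obtain _ | _ | n := n
  · omega
  · exact .one g
  -- Here the degree is `n + 2`, which exceeds 1, so `g` vanishes.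
  · rw [eq_zero_of_dimIn_lt (ht.trans_lt (by norm_cast; omega)) hA hB g]
    exact factorsThrough_zero hB _

end Heart

end ExtGroups

theorem mainTheorem6 {C : Type u} [Category.{v} C] [Preadditive C] [HasZeroObject C] [HasShift C ℤ]
    [∀ n : ℤ, (shiftFunctor C n).Additive] [Pretriangulated C] [IsTriangulated C] :
    (∀ (P : ObjectProperty C) [ExtGroups.IsDyerSubcategory P],
      ExtGroups.HasAllExtGroups P ↔
        ∀ (n : ℕ), 1 ≤ n → ∀ (A B : C), P A → P B → ∀ g : A ⟶ B⟦(n : ℤ)⟧,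
          ExtGroups.FactorsThrough P A n B g) ∧
    (∀ t : TStructure C, ExtGroups.dimIn t.heart ≤ 1 →
      ExtGroups.HasAllExtGroups t.heart ∧
        ExtGroups.absDim t.heart.FullSubcategory = ExtGroups.dimIn t.heart) := by
  refine ⟨fun P _ => ExtGroups.hasAllExtGroups_iff_factorsThrough, fun t ht => ?_⟩
  have h := ExtGroups.hasAllExtGroups_of_dimIn_le_one t ht
  refine ⟨h, ?_⟩
  rw [ExtGroups.absDim, ExtGroups.shortExactSequences_heart]
  exact ExtGroups.extDim_eq_dimIn_of_hasAllExtGroups t h
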